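/- Theorem. Let $\mathbb F_q$ be a finite field and $\overline{\mathbb F}_q$ its algebraic closure; write $\mathbb A^r$ and $\mathbb P^r$ for affine and projective $r$-space over $\overline{\mathbb F}_q$ with the Zariski topology. Let $d,n$ be integers with $1\le d\le n-3$, and let $2\le m_1<\dots<m_d$ be integers, none divisible by $\mathrm{char}(\mathbb F_q)$. Put $P_{m_j}=X_1^{m_j}+\dots+X_n^{m_j}$. Let $f\in\mathbb F_q[Y_1,\dots,Y_d]$, give $Y_j$ the weight $m_j$, let $\mathrm{wt}(f)$ be the weight of $f$ and $f^{\mathrm{wt}}$ its component of highest weight, and suppose that $(H_1)$ $\nabla f\ne 0$ at every point of $\mathbb A^d$, and $(H_2)$ $\nabla f^{\mathrm{wt}}\ne 0$ at every point of $\mathbb A^d$. For $g\in\mathbb F_q[X_1,\dots,X_n]$ put $R_g=f(P_{m_1},\dots,P_{m_d})+g$, let $V_g=\{R_g=0\}\subset\mathbb A^n$ and let $\mathrm{pcl}(V_g)\subset\mathbb P^n$ be the projective closure of $V_g$. A point $x$ of a variety $V$ is singular if $\dim \mathcal T_xV\neq\dim_xV$, where $\mathcal T_xV$ is the tangent space defined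 by the ideal $I(V)$ in an affine chart around $x$ and $\dim_xV$ is the maximal dimension of an irreducible component of $V$ through $x$. (a) Let $g=X_1^e+\dots+X_n^e+g_1$, where $e\ge1$ is not divisible by $\mathrm{char}(\mathbb F_q)$ and $\deg g_1<e$. If $e=\mathrm{wt}(f)=m_k$ for some $k$, suppose also that the power sum $P_{m_k}=P_e$ does not cancel in $R_g$, that is, that the coefficient of the monomial $Y_k$ in $f$ is not $-1$. Then the singular locus of $\mathrm{pcl}(V_g)$ has dimension at most $d$. (b) If $g\in\mathbb F_q$ is constant, then the singular locus of $\mathrm{pcl}(V_g)$ has dimension at most $d-1$. (The empty set has dimension $-\infty$.) -/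

import Mathlib

open MvPolynomial

noncomputable section

namespace DeformedHypersurface

universe u

variable {K : Type u} [Field K]

section Affine

/-- The affine zero set in `𝔸ⁿ = Kⁿ` of a set of polynomials. -/
def affZeros {n : ℕ} (S : Set (MvPolynomial (Fin n) K)) : Set (Fin n → K) :=
  {x | ∀ p ∈ S, eval x p = 0}

/-- The Zariski topology on `𝔸ⁿ = Kⁿ`: the closed sets are the affine varieties. -/
@[reducible] def affZariski (K : Type u) [Field K] (n : ℕ) : TopologicalSpace (Fin n → K) :=
  TopologicalSpace.ofClosed {C | ∃ S : Set (MvPolynomial (Fin n) K), C = affZeros S}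
    ⟨{1}, by ext x; simp [affZeros]⟩
    (by
      intro A hA
      refine ⟨{p | ∃ S : Set (MvPolynomial (Fin n) K), affZeros S ∈ A ∧ p ∈ S}, ?_⟩
      ext x
      constructor
      · rintro hx p ⟨S, hS, hp⟩
        exact hx _ hS p hp
      · intro hx C hC
        obtain ⟨S, rfl⟩ := hA hC
        exact fun p hp => hx p ⟨S, hC, hp⟩)
    (by
      rintro _ ⟨S, rfl⟩ _ ⟨T, rfl⟩
      refine ⟨{r | ∃ p ∈ S, ∃ q ∈ T, r = p * q}, ?_⟩
      ext x
      constructor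
      · rintro (hx | hx) _ ⟨p, hp, q, hq, rfl⟩
        · simp [hx p hp]
        · simp [hx q hq]
      · intro hx
        by_contra hcon
        simp only [Set.mem_union, not_or, affZeros, Set.mem_ofPred_eq, not_forall] at hcon
        obtain ⟨⟨p, hp, hp0⟩, ⟨q, hq, hq0⟩⟩ := hcon
        have := hx _ ⟨p, hp, q, hq, rfl⟩
        rw [map_mul] at this
        exact (mul_ne_zero hp0 hq0) this)

/-- The dimension of a subset of `𝔸ⁿ` in the Zariski topology: the supremum of the lengths of
chains of irreducible closed subsets (`⊥` for the empty set). -/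
def affDim {n : ℕ} (V : Set (Fin n → K)) : WithBot ℕ∞ :=
  letI := affZariski K n
  topologicalKrullDim V

/-- `Z` is an irreducible component of `V ⊆ 𝔸ⁿ`: a maximal irreducible subset of `V`. -/
def IsAffComponent {n : ℕ} (V Z : Set (Fin n → K)) : Prop :=
  letI := affZariski K n
  Maximal (fun W => IsIrreducible W ∧ W ⊆ V) Z

/-- `dimₓ V`: the maximum of the dimensions of the irreducible components of `V` through `x`. -/
def affDimAt {n : ℕ} (V : Set (Fin n → K)) (x : Fin n → K) : WithBot ℕ∞ :=
  ⨆ Z ∈ {Z | IsAffComponent V Z ∧ x ∈ Z}, affDim Z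

/-- The tangent space of `V ⊆ 𝔸ⁿ` at `x`: the vectors killed by the Jacobian at `x` of the
polynomials in the defining ideal `I(V)`. -/
def tangentSpace {n : ℕ} (V : Set (Fin n → K)) (x : Fin n → K) : Submodule K (Fin n → K) where
  carrier := {v | ∀ F ∈ vanishingIdeal K V, ∑ j, eval x (pderiv j F) * v j = 0}
  zero_mem' := by simp
  add_mem' := by
    intro v w hv hw F hF
    simp [mul_add, Finset.sum_add_distrib, hv F hF, hw F hF]
  smul_mem' := by
    intro c v hv F hF
    have : ∑ j, eval x (pderiv j F) * (c • v) j = c * ∑ j, eval x (pderiv j F) * v j := by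
      rw [Finset.mul_sum]
      refine Finset.sum_congr rfl fun j _ => ?_
      simp only [Pi.smul_apply, smul_eq_mul]
      ring
    rw [this, hv F hF, mul_zero]

/-- `x` is a singular point of the affine variety `V`: `x ∈ V` and `dim 𝒯ₓV ≠ dimₓ V`. -/
def IsAffSingularPoint {n : ℕ} (V : Set (Fin n → K)) (x : Fin n → K) : Prop :=
  x ∈ V ∧ ((Module.finrank K (tangentSpace V x) : ℕ) : WithBot ℕ∞) ≠ affDimAt V x

end Affine

section Projective

/-- The projective space `ℙⁿ` over `K`. -/
abbrev Proj (K : Type u) [Field K] (n : ℕ) : Type u := Projectivization K (Fin (n + 1) → K)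

/-- The zero set in `ℙⁿ` of a set of polynomials. It is used for homogeneous polynomials only, for
which the vanishing does not depend on the chosen representative. -/
def projZeros {n : ℕ} (S : Set (MvPolynomial (Fin (n + 1)) K)) : Set (Proj K n) :=
  {x | ∀ p ∈ S, eval x.rep p = 0}

/-- The Zariski topology on `ℙⁿ`: the closed sets are the zero sets of sets of homogeneous
polynomials. -/
@[reducible] def projZariski (K : Type u) [Field K] (n : ℕ) : TopologicalSpace (Proj K n) :=
  TopologicalSpace.ofClosed
    {C | ∃ S : Set (MvPolynomial (Fin (n + 1)) K),
      (∀ p ∈ S, ∃ k : ℕ, p.IsHomogeneous k) ∧ C = projZeros S}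
    ⟨{1}, by
      rintro p rfl
      exact ⟨0, isHomogeneous_one _ _⟩, by ext x; simp [projZeros]⟩
    (by
      intro A hA
      refine ⟨{p | ∃ S : Set (MvPolynomial (Fin (n + 1)) K),
        (∀ p ∈ S, ∃ k : ℕ, p.IsHomogeneous k) ∧ projZeros S ∈ A ∧ p ∈ S}, ?_, ?_⟩
      · rintro p ⟨S, hS, _, hp⟩
        exact hS p hp
      · ext x
        constructor
        · rintro hx p ⟨S, _, hS, hp⟩
          exact hx _ hS p hp
        · intro hx C hC
          obtain ⟨S, hS, rfl⟩ := hA hC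
          exact fun p hp => hx p ⟨S, hS, hC, hp⟩)
    (by
      rintro _ ⟨S, hS, rfl⟩ _ ⟨T, hT, rfl⟩
      refine ⟨{r | ∃ p ∈ S, ∃ q ∈ T, r = p * q}, ?_, ?_⟩
      · rintro _ ⟨p, hp, q, hq, rfl⟩
        obtain ⟨k, hk⟩ := hS p hp
        obtain ⟨l, hl⟩ := hT q hq
        exact ⟨k + l, hk.mul hl⟩
      · ext x
        constructor
        · rintro (hx | hx) _ ⟨p, hp, q, hq, rfl⟩
          · simp [hx p hp]
          · simp [hx q hq]
        · intro hx
          by_contra hcon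
          simp only [Set.mem_union, not_or, projZeros, Set.mem_ofPred_eq, not_forall] at hcon
          obtain ⟨⟨p, hp, hp0⟩, ⟨q, hq, hq0⟩⟩ := hcon
          have := hx _ ⟨p, hp, q, hq, rfl⟩
          rw [map_mul] at this
          exact (mul_ne_zero hp0 hq0) this)

/-- The dimension of a subset of `ℙⁿ` in the Zariski topology (`⊥` for the empty set). -/
def projDim {n : ℕ} (V : Set (Proj K n)) : WithBot ℕ∞ :=
  letI := projZariski K n
  topologicalKrullDim V

/-- The `i`-th standard affine chart `𝔸ⁿ → ℙⁿ`, which puts a coordinate `1` in position `i`. -/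
def chart {n : ℕ} (i : Fin (n + 1)) (y : Fin n → K) : Proj K n :=
  Projectivization.mk K (i.insertNth (α := fun _ => K) 1 y) (by
    intro h
    have := congrFun h i
    simp at this)

/-- The projective closure of `V ⊆ 𝔸ⁿ`: the Zariski closure in `ℙⁿ` of the image of `V` under
`x ↦ (1 : x₁ : ⋯ : xₙ)`. -/
def pcl {n : ℕ} (V : Set (Fin n → K)) : Set (Proj K n) :=
  letI := projZariski K n
  closure (chart 0 '' V)

/-- The singular locus of a projective variety: the points which are singular in an affine
chart containing them. -/
def projSingularLocus {n : ℕ} (V : Set (Proj K n)) : Set (Proj K n) :=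
  {x | ∃ (i : Fin (n + 1)) (y : Fin n → K), chart i y = x ∧ IsAffSingularPoint (chart i ⁻¹' V) y}

end Projective

section PowerSums

variable {F : Type u} [Field F]

/-- The component `f^wt` of highest weight of `f`, for the weight with `wt(Y_j) = m j`. -/
def topWeightComponent {d : ℕ} (m : Fin d → ℕ) (f : MvPolynomial (Fin d) F) :
    MvPolynomial (Fin d) F :=
  weightedHomogeneousComponent m (weightedTotalDegree m f) f

/-- The gradient of `f` vanishes at no point of `𝔸ᵈ` over the algebraic closure of `F`. -/
def GradientNowhereZero {d : ℕ} (f : MvPolynomial (Fin d) F) : Prop :=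
  ∀ y : Fin d → AlgebraicClosure F, ∃ j, aeval y (pderiv j f) ≠ 0

/-- `R_g = f(P_{m_1}, …, P_{m_d}) + g`, with `P_k = X_1^k + ⋯ + X_n^k`. -/
def Rpoly {d n : ℕ} (m : Fin d → ℕ) (f : MvPolynomial (Fin d) F) (g : MvPolynomial (Fin n) F) :
    MvPolynomial (Fin n) F :=
  aeval (fun j => psum (Fin n) F (m j)) f + g

/-- The affine variety `V_g ⊆ 𝔸ⁿ` over the algebraic closure of `F` defined by `R_g`. -/
def Vg {d n : ℕ} (m : Fin d → ℕ) (f : MvPolynomial (Fin d) F) (g : MvPolynomial (Fin n) F) :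
    Set (Fin n → AlgebraicClosure F) :=
  {x | aeval x (Rpoly m f g) = 0}

end PowerSums

end DeformedHypersurface

end

/-!
The proof bounds the singular locus of the projective closure through its section by the hyperplane
at infinity.

Let `R = R_g`, of degree `D`, with top form `T`, and let `Rʰ` be the homogenization of `R`. The
projective closure is the hypersurface `Rʰ = 0` (`mk_mem_pcl_iff`), and by the Jacobian criterion
and Euler's identity its singular points are common zeros of all partial derivatives of `Rʰ`
(`projSingularLocus_pcl_subset`). The criterion has to be proved for a polynomial which need not be
squarefree: near a point with nonzero gradient only one irreducible factor vanishes
(`not_isAffSingularPoint_of_pderiv_ne_zero`).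

A hyperplane section lowers the dimension of a projective variety by at most one, so it suffices
that the affine cone `∂T/∂X₁ = ⋯ = ∂T/∂Xₙ = 0` has dimension less than `d`
(`projDim_projZeros_le`, a consequence of Krull's height theorem).

Here `T` is `h(P_{m_1}, …, P_{m_d})` for `h = f^wt` or `h = f^wt + Y_k`, or else `T` is a single
power sum, which is the same shape with `d = 1`. By the chain rule
`∂T/∂Xᵢ = ∑ⱼ mⱼ (∂h/∂Yⱼ)(P) Xᵢ ^ (mⱼ - 1)`. Since `∇f^wt` does not vanish at the origin, `f^wt`
contains a linear term in some `Y_k`, and for weight reasons `∂h/∂Y_k` is then a nonzero constant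
(`exists_pderiv_topWeightComponent`; in the case `h = f^wt + Y_k` this is where the power sum must
not cancel). So on each component of the cone all coordinates are roots of one nonzero polynomial
with `d` fixed distinct exponents. Were `d` of the coordinates algebraically independent, a
generalized Vandermonde determinant in them would vanish, which it does not
(`det_X_pow_ne_zero`). Hence the transcendence degree, and by Noether normalization the dimension,
is less than `d` (`ringKrullDim_le_of_relation`).

In all cases this gives dimension at most `d - 1`.
-/

namespace DeformedHypersurface

/-! ### Algebras generated by roots of one sparse polynomial -/

/-- The generalized Vandermonde determinant with distinct exponents is a nonzero polynomial: the
monomials in its Leibniz expansion are pairwise distinct. -/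
theorem det_X_pow_ne_zero (K : Type*) [Field K] {d : ℕ} {a : Fin d → ℕ}
    (ha : Function.Injective a) :
    (Matrix.of fun i j : Fin d => (X i : MvPolynomial (Fin d) K) ^ a j).det ≠ 0 := by
  classical
  have key : ∀ σ : Equiv.Perm (Fin d),
      ∏ i, (X (σ i) : MvPolynomial (Fin d) K) ^ a i =
        monomial (Finsupp.equivFunOnFinite.symm fun i => a (σ.symm i)) 1 := by
    intro σ
    rw [monomial_eq, C_1, one_mul, Finsupp.prod_fintype _ _ (by simp)]
    rw [← Equiv.prod_comp σ fun x => X x ^ (Finsupp.equivFunOnFinite.symm fun i => a (σ.symm i)) x]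
    simp
  intro h
  have h1 := congrArg (coeff (Finsupp.equivFunOnFinite.symm a)) h
  rw [Matrix.det_apply, coeff_sum, Finset.sum_eq_single 1] at h1
  · simp only [Equiv.Perm.sign_one, one_smul, Matrix.of_apply] at h1
    rw [key 1] at h1
    rw [coeff_monomial, if_pos (by rfl), coeff_zero] at h1
    exact one_ne_zero h1
  · intro σ _ hσ
    simp only [Matrix.of_apply]
    rw [key σ, Units.smul_def, coeff_smul, coeff_monomial, if_neg, smul_zero]
    intro h2
    apply hσ
    ext i
    have h3 := congrFun (congrArg DFunLike.coe h2) (σ i)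
    simp only [Finsupp.equivFunOnFinite_symm_apply_apply, Equiv.symm_apply_apply] at h3
    rw [← ha h3]
    rfl
  · simp

/-- If `x₁, …, x_d` in a domain all satisfy one nontrivial relation `∑ cⱼ xᵢ ^ aⱼ = 0` with
distinct exponents, then they are algebraically dependent. -/
theorem not_algebraicIndependent_of_relation {K C : Type*} [Field K] [CommRing C] [IsDomain C]
    [Algebra K C] {d : ℕ} {a : Fin d → ℕ} (ha : Function.Injective a) (x : Fin d → C)
    (c : Fin d → C) (hc : c ≠ 0) (h : ∀ i, ∑ j, c j * x i ^ a j = 0) :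
    ¬ AlgebraicIndependent K x := by
  intro hx
  have hdet := det_X_pow_ne_zero K ha
  have h1 : (Matrix.of fun i j : Fin d => x i ^ a j).det ≠ 0 := by
    have : (Matrix.of fun i j : Fin d => x i ^ a j).det =
        aeval x (Matrix.of fun i j : Fin d => (X i : MvPolynomial (Fin d) K) ^ a j).det := by
      rw [AlgHom.map_det]
      congr 1
      ext i j
      simp
    rw [this]
    intro h0
    exact hdet (hx (by simpa using h0))
  apply hc
  apply Matrix.eq_zero_of_mulVec_eq_zero h1
  ext i
  simp only [Matrix.mulVec, dotProduct, Matrix.of_apply, Pi.zero_apply]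
  rw [← h i]
  exact Finset.sum_congr rfl fun j _ => mul_comm _ _

theorem card_lt_of_algebraicIndependent_of_relation {K C : Type*} [Field K] [CommRing C]
    [IsDomain C] [Algebra K C] {d n : ℕ} {a : Fin d → ℕ} (ha : Function.Injective a)
    (x : Fin n → C) (hx : Algebra.adjoin K (Set.range x) = ⊤)
    (c : Fin d → C) (hc : c ≠ 0) (h : ∀ i, ∑ j, c j * x i ^ a j = 0)
    {s : ℕ} (z : Fin s → C) (hz : AlgebraicIndependent K z) : s < d := by
  have : Algebra.IsAlgebraic (Algebra.adjoin K (Set.range x)) C := by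
    constructor
    intro y
    have hy : y ∈ Algebra.adjoin K (Set.range x) := hx ▸ Algebra.mem_top
    exact isAlgebraic_algebraMap (⟨y, hy⟩ : Algebra.adjoin K (Set.range x))
  obtain ⟨t, htx, ht⟩ := exists_isTranscendenceBasis_subset (R := K) (Set.range x)
  have h1 := ht.lift_cardinalMk_eq_trdeg
  have h2 := hz.lift_cardinalMk_le_trdeg
  have : Finite t := (Set.finite_range x).subset htx
  have := Fintype.ofFinite t
  rw [Cardinal.lift_id] at h1
  simp only [Cardinal.lift_id, Cardinal.mk_fintype, Fintype.card_fin, Cardinal.lift_natCast,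
    Cardinal.lift_uzero] at h1 h2
  rw [← h1] at h2
  have h3 : s ≤ Fintype.card t := by
    simpa using h2
  by_contra hsd
  obtain ⟨ι⟩ : Nonempty (Fin d ↪ t) :=
    Function.Embedding.nonempty_of_card_le (by rw [Fintype.card_fin]; omega)
  have hind := ht.1.comp ι ι.injective
  refine not_algebraicIndependent_of_relation ha _ c hc (fun i => ?_) hind
  obtain ⟨k, hk⟩ := htx (ι i).2
  simp only [Function.comp_apply, ← hk]
  exact h k

theorem ringKrullDim_le_of_isIntegral {A B : Type*} [CommRing A] [CommRing B] (f : A →+* B)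
    (hf : f.IsIntegral) : ringKrullDim B ≤ ringKrullDim A := by
  algebraize [f]
  have : Algebra.IsIntegral A B := ⟨hf⟩
  refine Order.krullDim_le_of_strictMono (PrimeSpectrum.comap (algebraMap A B)) ?_
  intro p q hpq
  exact Ideal.IsIntegral.comap_lt_comap (R := A) hpq

/-- A `K`-algebra generated by elements `bᵢ` which all satisfy one relation `∑ cⱼ bᵢ ^ aⱼ = 0` with
`d` distinct exponents and one invertible coefficient has Krull dimension less than `d`. After
Noether normalization `K[z₁, …, z_s] ⊆ B`, the bound `s < d` is obtained modulo a prime lying over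
zero. -/
theorem ringKrullDim_le_of_relation {K B : Type*} [Field K] [CommRing B] [Algebra K B]
    {d n : ℕ} {a : Fin d → ℕ} (ha : Function.Injective a) (b : Fin n → B)
    (hb : Algebra.adjoin K (Set.range b) = ⊤) (c : Fin d → B) {k : Fin d} (hc : IsUnit (c k))
    (h : ∀ i, ∑ j, c j * b i ^ a j = 0) :
    ringKrullDim B ≤ ((d - 1 : ℕ) : WithBot ℕ∞) := by
  cases subsingleton_or_nontrivial B
  · rw [ringKrullDim_eq_bot_of_subsingleton]; exact bot_le
  have : Algebra.FiniteType K B :=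
    ⟨⟨(Set.finite_range b).toFinset, by simpa using hb⟩⟩
  obtain ⟨s, g, hg, hgi⟩ := exists_integral_inj_algHom_of_fg K B
  have h1 : ringKrullDim B ≤ (s : WithBot ℕ∞) := by
    refine (ringKrullDim_le_of_isIntegral g.toRingHom hgi).trans ?_
    rw [MvPolynomial.ringKrullDim_of_isNoetherianRing, ringKrullDim_eq_zero_of_field]
    simp
  refine h1.trans ?_
  suffices s < d by exact_mod_cast (by omega : s ≤ d - 1)
  obtain ⟨q, hq, hq0⟩ := Ideal.exists_comap_eq_of_mem_minimalPrimes_of_injective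
    (f := g.toRingHom) hg ⊥ (by simp [IsDomain.minimalPrimes_eq_singleton_bot])
  let π := Ideal.Quotient.mkₐ K q
  refine card_lt_of_algebraicIndependent_of_relation (K := K) ha (fun i => π (b i)) ?_
    (fun j => π (c j)) ?_ ?_ (fun i => π (g (X i))) ?_
  · have : Set.range (fun i => π (b i)) = π '' Set.range b := by
      rw [← Set.range_comp]; rfl
    rw [this, ← AlgHom.map_adjoin, hb, Algebra.map_top, AlgHom.range_eq_top]
    exact Ideal.Quotient.mkₐ_surjective K q
  · intro h0
    have h2 := congrFun h0 k
    exact (hc.map π).ne_zero h2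
  · intro i
    have := congrArg π (h i)
    simpa using this
  · have : (aeval fun i => π (g (X i)) : MvPolynomial (Fin s) K →ₐ[K] B ⧸ q) = π.comp g := by
      ext i; simp
    rw [AlgebraicIndependent, this, injective_iff_map_eq_zero]
    intro p hp
    have hp' : g p ∈ q := by
      simpa [π, Ideal.Quotient.eq_zero_iff_mem] using hp
    have : p ∈ Ideal.comap g.toRingHom q := hp'
    rw [hq0] at this
    simpa using this

/-! ### Affine varieties and the Jacobian criterion -/

section AffineGeometry

open scoped Topology

theorem isIrreducible_of_image_val {X : Type*} [TopologicalSpace X] {V : Set X} {S : Set V}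
    (h : IsIrreducible (Subtype.val '' S)) : IsIrreducible S := by
  refine ⟨h.1.of_image, ?_⟩
  rintro U W hU hW ⟨u, huS, huU⟩ ⟨w, hwS, hwW⟩
  obtain ⟨U', hU', rfl⟩ := isOpen_induced_iff.1 hU
  obtain ⟨W', hW', rfl⟩ := isOpen_induced_iff.1 hW
  obtain ⟨_, ⟨z, hzS, rfl⟩, hz⟩ := h.2 U' W' hU' hW' ⟨u, ⟨u, huS, rfl⟩, huU⟩ ⟨w, ⟨w, hwS, rfl⟩, hwW⟩
  exact ⟨z, hzS, hz⟩

variable {K : Type*} [Field K]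

theorem isClosed_affZariski_iff {n : ℕ} (C : Set (Fin n → K)) :
    IsClosed[affZariski K n] C ↔ ∃ S : Set (MvPolynomial (Fin n) K), C = affZeros S := by
  rw [← @isOpen_compl_iff _ _ (affZariski K n)]
  change Cᶜᶜ ∈ {C | ∃ S : Set (MvPolynomial (Fin n) K), C = affZeros S} ↔ _
  rw [compl_compl]
  rfl

theorem isClosed_zeroLocus {n : ℕ} (I : Ideal (MvPolynomial (Fin n) K)) :
    IsClosed[affZariski K n] (zeroLocus K I) :=
  (isClosed_affZariski_iff _).2 ⟨I, by ext x; simp [affZeros, mem_zeroLocus_iff, aeval_eq_eval]⟩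

theorem zeroLocus_vanishingIdeal_of_isClosed {n : ℕ} {C : Set (Fin n → K)}
    (hC : IsClosed[affZariski K n] C) : zeroLocus K (vanishingIdeal K C) = C := by
  refine le_antisymm (fun x hx => ?_) (zeroLocus_vanishingIdeal_le C)
  obtain ⟨S, rfl⟩ := (isClosed_affZariski_iff _).1 hC
  intro p hp
  have := hx p fun y hy => by simpa [aeval_eq_eval] using hy p hp
  simpa [aeval_eq_eval] using this

theorem vanishingIdeal_lt_of_isClosed {n : ℕ} {C D : Set (Fin n → K)}
    (hC : IsClosed[affZariski K n] C) (hD : IsClosed[affZariski K n] D) (h : C < D) :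
    vanishingIdeal K D < vanishingIdeal K C := by
  refine lt_of_le_of_ne (vanishingIdeal_anti_mono h.le) fun he => h.ne ?_
  rw [← zeroLocus_vanishingIdeal_of_isClosed hC, ← zeroLocus_vanishingIdeal_of_isClosed hD, he]

theorem isPrime_vanishingIdeal {n : ℕ} {C : Set (Fin n → K)}
    (hC : @IsIrreducible _ (affZariski K n) C) : (vanishingIdeal K C).IsPrime := by
  refine Ideal.isPrime_iff.2 ⟨?_, ?_⟩
  · obtain ⟨x, hx⟩ := hC.1
    rw [Ideal.ne_top_iff_one]
    intro h1
    simpa using h1 x hx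
  · intro p q hpq
    have h2 := (@isPreirreducible_iff_isClosed_union_isClosed _ (affZariski K n) C).1 hC.2
    have := h2 _ _ (isClosed_zeroLocus (Ideal.span {p})) (isClosed_zeroLocus (Ideal.span {q})) ?_
    · simpa only [← le_zeroLocus_iff_le_vanishingIdeal,
        ← Ideal.span_singleton_le_iff_mem] using this
    · intro x hx
      have := hpq x hx
      rw [map_mul, mul_eq_zero] at this
      simpa [zeroLocus_span] using this

theorem exists_prime_factor_eval_eq_zero {n : ℕ} {Q : MvPolynomial (Fin n) K} (hQ : Q ≠ 0)
    {y : Fin n → K} (hy : eval y Q = 0) :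
    ∃ p u : MvPolynomial (Fin n) K, Prime p ∧ Q = p * u ∧ eval y p = 0 := by
  obtain ⟨w, hw⟩ := UniqueFactorizationMonoid.factors_prod hQ
  rw [← hw, map_mul, mul_eq_zero] at hy
  have hw0 : eval y (w : MvPolynomial (Fin n) K) ≠ 0 := (w.isUnit.map (eval y)).ne_zero
  have h1 := hy.resolve_right hw0
  rw [map_multiset_prod, Multiset.prod_eq_zero_iff, Multiset.mem_map] at h1
  obtain ⟨p, hp, hpy⟩ := h1
  obtain ⟨u, hu⟩ := UniqueFactorizationMonoid.dvd_of_mem_factors hp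
  exact ⟨p, u, UniqueFactorizationMonoid.prime_of_factor p hp, hu, hpy⟩

variable [IsAlgClosed K]

theorem isIrreducible_zeroLocus {n : ℕ} (q : Ideal (MvPolynomial (Fin n) K)) [hq : q.IsPrime] :
    @IsIrreducible _ (affZariski K n) (zeroLocus K q) := by
  have hv := IsPrime.vanishingIdeal_zeroLocus (K := K) q
  refine ⟨?_, ?_⟩
  · by_contra h
    rw [Set.not_nonempty_iff_eq_empty] at h
    rw [h, vanishingIdeal_empty] at hv
    exact hq.ne_top hv.symm
  · rw [@isPreirreducible_iff_isClosed_union_isClosed _ (affZariski K n)]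
    intro A B hA hB h
    by_contra hcon
    rw [not_or] at hcon
    have key : ∀ C : Set (Fin n → K), IsClosed[affZariski K n] C → ¬ zeroLocus K q ⊆ C →
        ∃ p ∈ vanishingIdeal K C, p ∉ q := by
      intro C hC hqC
      by_contra! h3
      apply hqC
      rw [← zeroLocus_vanishingIdeal_of_isClosed hC]
      exact zeroLocus_anti_mono h3
    obtain ⟨p, hp, hpq⟩ := key A hA hcon.1
    obtain ⟨r, hr, hrq⟩ := key B hB hcon.2
    have : p * r ∈ q := by
      rw [← hv]
      intro x hx
      rw [map_mul]
      rcases h hx with hx | hx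
      · rw [hp x hx, zero_mul]
      · rw [hr x hx, mul_zero]
    exact (hq.mem_or_mem this).elim hpq hrq

/-- The dimension of an irreducible affine variety is the Krull dimension of its coordinate ring:
by the Nullstellensatz its irreducible closed subsets correspond to the primes above `q`. -/
theorem affDim_zeroLocus {n : ℕ} (q : Ideal (MvPolynomial (Fin n) K)) [q.IsPrime] :
    affDim (zeroLocus K q) = ringKrullDim (MvPolynomial (Fin n) K ⧸ q) := by
  let := affZariski K n
  rw [ringKrullDim_quotient]
  change topologicalKrullDim (zeroLocus K q) = _
  rw [topologicalKrullDim]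
  have hcl := isClosed_zeroLocus q
  apply le_antisymm
  · rw [← Order.krullDim_orderDual
      (α := PrimeSpectrum.zeroLocus (q : Set (MvPolynomial (Fin n) K)))]
    refine Order.krullDim_le_of_strictMono (fun W => OrderDual.toDual
      ⟨⟨vanishingIdeal K (Subtype.val '' (W : Set (zeroLocus K q))),
        isPrime_vanishingIdeal (W.isIrreducible.image _ continuous_subtype_val.continuousOn)⟩,
        ?_⟩) ?_
    · change q ≤ _
      rw [← le_zeroLocus_iff_le_vanishingIdeal]
      rintro _ ⟨x, _, rfl⟩
      exact x.2
    · intro W W' hW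
      refine vanishingIdeal_lt_of_isClosed (hcl.isClosedMap_subtype_val _ W.isClosed)
        (hcl.isClosedMap_subtype_val _ W'.isClosed) ?_
      exact Subtype.val_injective.image_strictMono hW
  · rw [← Order.krullDim_orderDual
      (α := PrimeSpectrum.zeroLocus (q : Set (MvPolynomial (Fin n) K)))]
    have hsub : ∀ P : PrimeSpectrum.zeroLocus (q : Set (MvPolynomial (Fin n) K)),
        Subtype.val '' (Subtype.val ⁻¹' (zeroLocus K P.1.asIdeal) : Set (zeroLocus K q)) =
          zeroLocus K P.1.asIdeal := by
      intro P
      rw [Subtype.image_preimage_coe, Set.inter_eq_right]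
      exact zeroLocus_anti_mono P.2
    refine Order.krullDim_le_of_strictMono (fun P =>
      (⟨Subtype.val ⁻¹' (zeroLocus K (OrderDual.ofDual P).1.asIdeal), ?_,
        (isClosed_zeroLocus _).preimage continuous_subtype_val⟩ :
        TopologicalSpace.IrreducibleCloseds (zeroLocus K q))) ?_
    · refine isIrreducible_of_image_val ?_
      rw [hsub]
      exact isIrreducible_zeroLocus _
    · intro P P' hP
      have h1 : (OrderDual.ofDual P').1.asIdeal < (OrderDual.ofDual P).1.asIdeal := hP
      have h2 : zeroLocus K (OrderDual.ofDual P).1.asIdeal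
          < zeroLocus K (OrderDual.ofDual P').1.asIdeal := by
        refine lt_of_le_of_ne (zeroLocus_anti_mono h1.le) fun he => h1.ne ?_
        rw [← IsPrime.vanishingIdeal_zeroLocus (K := K) (OrderDual.ofDual P).1.asIdeal, he,
          IsPrime.vanishingIdeal_zeroLocus]
      rw [← hsub (OrderDual.ofDual P), ← hsub (OrderDual.ofDual P')] at h2
      exact (Subtype.val_injective.injOn.image_ssubset_image_iff
        (Set.subset_univ _) (Set.subset_univ _)).1 h2

/-- The maximal ideals of a polynomial ring over an algebraically closed field all have the same
height, as translations permute the points of affine space transitively, and so this height is at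
least the dimension of the ring. -/
theorem height_vanishingIdeal_singleton {n : ℕ} (y : Fin n → K) :
    (n : ℕ∞) ≤ (vanishingIdeal K {y} : Ideal (MvPolynomial (Fin n) K)).height := by
  have hdim : ringKrullDim (MvPolynomial (Fin n) K) = (n : WithBot ℕ∞) := by
    rw [MvPolynomial.ringKrullDim_of_isNoetherianRing, ringKrullDim_eq_zero_of_field]
    simp
  have h2 : ringKrullDim (MvPolynomial (Fin n) K) ≤
      ((vanishingIdeal K {y} : Ideal (MvPolynomial (Fin n) K)).height : WithBot ℕ∞) := by
    rw [ringKrullDim_le_iff_isMaximal_height_le]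
    intro M hM
    obtain ⟨x, rfl⟩ := (isMaximal_iff_eq_vanishingIdeal_singleton).1 hM
    have hcomp : ∀ u v : Fin n → K, u + v = 0 →
        ((aeval fun i => X i + C (u i) : MvPolynomial (Fin n) K →ₐ[K] _).comp
          (aeval fun i => X i + C (v i))) = AlgHom.id K (MvPolynomial (Fin n) K) := by
      intro u v huv
      ext i : 1
      have : u i + v i = 0 := congrFun huv i
      simp [add_assoc, ← C_add, this, algebraMap_eq]
    let e : MvPolynomial (Fin n) K ≃ₐ[K] MvPolynomial (Fin n) K :=
      AlgEquiv.ofAlgHom (aeval fun i => X i + C ((x - y) i)) (aeval fun i => X i + C ((y - x) i))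
        (hcomp _ _ (by simp)) (hcomp _ _ (by simp))
    have he : (vanishingIdeal K {x} : Ideal (MvPolynomial (Fin n) K)) =
        (vanishingIdeal K {y}).comap e.toRingEquiv := by
      ext p
      rw [Ideal.mem_comap, mem_vanishingIdeal_singleton_iff, mem_vanishingIdeal_singleton_iff]
      have : (aeval y).comp (aeval fun i => X i + C ((x - y) i) :
          MvPolynomial (Fin n) K →ₐ[K] MvPolynomial (Fin n) K) = aeval x := by
        ext i; simp
      rw [← this]
      rfl
    rw [he, RingEquiv.height_comap]
  rw [hdim] at h2
  exact_mod_cast h2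

theorem ringKrullDim_quotient_span_prime {n : ℕ} {p : MvPolynomial (Fin n) K} (hp : Prime p) :
    ringKrullDim (MvPolynomial (Fin n) K ⧸ Ideal.span {p}) = ((n - 1 : ℕ) : WithBot ℕ∞) := by
  have hdim : ringKrullDim (MvPolynomial (Fin n) K) = (n : WithBot ℕ∞) := by
    rw [MvPolynomial.ringKrullDim_of_isNoetherianRing, ringKrullDim_eq_zero_of_field]
    simp
  have h1 := ringKrullDim_quotient_succ_le_of_nonZeroDivisor
    (mem_nonZeroDivisors_of_ne_zero hp.ne_zero)
  have : (Ideal.span {p}).IsPrime := (Ideal.span_singleton_prime hp.ne_zero).2 hp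
  -- For the lower bound, cut the maximal ideal of a zero of `p`, of height at least `n`, by `p`.
  obtain ⟨y, hy⟩ := (isIrreducible_zeroLocus (Ideal.span {p})).1
  have hpy : p ∈ vanishingIdeal K {y} := by
    rw [mem_vanishingIdeal_singleton_iff]
    exact hy p (Ideal.mem_span_singleton_self p)
  have h2 := Ideal.height_le_ringKrullDim_quotient_add_one hpy
  have h3 : (n : WithBot ℕ∞) ≤
      ((vanishingIdeal K {y} : Ideal (MvPolynomial (Fin n) K)).height : WithBot ℕ∞) := by
    exact_mod_cast height_vanishingIdeal_singleton y
  have h4 := h3.trans h2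
  rw [hdim] at h1
  have h5 := le_antisymm h1 h4
  generalize ringKrullDim (MvPolynomial (Fin n) K ⧸ Ideal.span {p}) = D at h5
  induction D with
  | bot => simp at h5
  | coe D =>
    have h6 : D + 1 = (n : ℕ∞) := by exact_mod_cast h5
    have h7 : D ≠ ⊤ := by rintro rfl; simp at h6
    lift D to ℕ using h7
    have : D + 1 = n := by exact_mod_cast h6
    have : D = n - 1 := by omega
    subst this
    rfl

/-- **Jacobian criterion** for hypersurfaces, one direction: a zero of `Q` at which some partial
derivative of `Q` does not vanish is a nonsingular point of the (reduced) variety `Q = 0`. Exactly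
one irreducible factor `p` of `Q` vanishes there, so that both the tangent space and the local
dimension are those of `p = 0`. -/
theorem not_isAffSingularPoint_of_pderiv_ne_zero {n : ℕ} {Q : MvPolynomial (Fin n) K}
    {y : Fin n → K} {j : Fin n} (hj : eval y (pderiv j Q) ≠ 0) :
    ¬ IsAffSingularPoint {x | eval x Q = 0} y := by
  rintro ⟨hy, hsing⟩
  apply hsing
  have hQ : Q ≠ 0 := by rintro rfl; simp at hj
  obtain ⟨p, u, hp, hQpu, hpy⟩ := exists_prime_factor_eval_eq_zero hQ hy
  have hpd : ∀ i, eval y (pderiv i Q) = eval y u * eval y (pderiv i p) := by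
    intro i
    rw [hQpu, pderiv_mul]
    simp [hpy, mul_comm]
  have huy : eval y u ≠ 0 := by
    intro h; apply hj; rw [hpd, h, zero_mul]
  have hpj : eval y (pderiv j p) ≠ 0 := by
    intro h; apply hj; rw [hpd, h, mul_zero]
  have : (Ideal.span {p}).IsPrime := (Ideal.span_singleton_prime hp.ne_zero).2 hp
  have hV : zeroLocus K (Ideal.span {p}) ⊆ {x | eval x Q = 0} := by
    intro x hx
    have : aeval x p = 0 := hx p (Ideal.mem_span_singleton_self p)
    simp only [Set.mem_ofPred_eq, hQpu, map_mul]
    rw [← aeval_eq_eval, this, zero_mul]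
  have hyp : y ∈ zeroLocus K (Ideal.span {p}) := by
    rw [zeroLocus_span]
    simpa [aeval_eq_eval] using hpy
  have hker : ∀ v, v ∈ tangentSpace {x | eval x Q = 0} y ↔
      ∑ i, eval y (pderiv i p) * v i = 0 := by
    intro v
    constructor
    · intro hv
      have h1 := hv Q fun x hx => by simpa [aeval_eq_eval] using hx
      simp only [hpd, mul_assoc, ← Finset.mul_sum] at h1
      exact (mul_eq_zero.1 h1).resolve_left huy
    · intro hv F hF
      have : F ∈ vanishingIdeal K (zeroLocus K (Ideal.span {p})) := vanishingIdeal_anti_mono hV hF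
      rw [IsPrime.vanishingIdeal_zeroLocus, Ideal.mem_span_singleton] at this
      -- Since `p` vanishes at `y`, the gradient of `p * w` at `y` is `w(y)` times that of `p`.
      obtain ⟨w, rfl⟩ := this
      have : ∀ i, eval y (pderiv i (p * w)) * v i = eval y w * (eval y (pderiv i p) * v i) := by
        intro i
        rw [pderiv_mul]
        simp [hpy]; ring
      simp only [this, ← Finset.mul_sum, hv, mul_zero]
  have hfin : Module.finrank K (tangentSpace {x | eval x Q = 0} y) = n - 1 := by
    let φ : (Fin n → K) →ₗ[K] K := Fintype.linearCombination K fun i => eval y (pderiv i p)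
    have hφ : tangentSpace {x | eval x Q = 0} y = LinearMap.ker φ := by
      ext v
      rw [hker, LinearMap.mem_ker]
      simp [φ, Fintype.linearCombination_apply, mul_comm]
    have hr : LinearMap.range φ = ⊤ := by
      refine LinearMap.range_eq_top.2 (LinearMap.surjective ?_)
      intro h0
      apply hpj
      have := LinearMap.congr_fun h0 (Pi.single j 1)
      simpa [φ, Fintype.linearCombination_apply, Pi.single_apply] using this
    have := LinearMap.finrank_range_add_finrank_ker φ
    rw [hr, finrank_top, Module.finrank_self, Module.finrank_fin_fun] at this
    rw [hφ]
    omega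
  -- As `u` does not vanish at `y`, an irreducible subset of `Q = 0` through `y` lies in `p = 0`.
  have hle : ∀ Z : Set (Fin n → K), @IsIrreducible _ (affZariski K n) Z →
      Z ⊆ {x | eval x Q = 0} → y ∈ Z → Z ⊆ zeroLocus K (Ideal.span {p}) := by
    intro Z hZ hZV hyZ
    have h1 := (@isPreirreducible_iff_isClosed_union_isClosed _ (affZariski K n) Z).1 hZ.2
      _ _ (isClosed_zeroLocus (Ideal.span {p})) (isClosed_zeroLocus (Ideal.span {u})) ?_
    · refine h1.resolve_right fun h2 => huy ?_
      have := h2 hyZ u (Ideal.mem_span_singleton_self u)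
      simpa [aeval_eq_eval] using this
    · intro x hx
      have := hZV hx
      simp only [Set.mem_ofPred_eq, hQpu, map_mul, mul_eq_zero] at this
      simpa [zeroLocus_span, aeval_eq_eval] using this
  have hcomp : ∀ Z, (IsAffComponent {x | eval x Q = 0} Z ∧ y ∈ Z) ↔
      Z = zeroLocus K (Ideal.span {p}) := by
    intro Z
    constructor
    · rintro ⟨hZ, hyZ⟩
      refine (hle Z hZ.1.1 hZ.1.2 hyZ).antisymm ?_
      exact hZ.2 ⟨isIrreducible_zeroLocus _, hV⟩ (hle Z hZ.1.1 hZ.1.2 hyZ)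
    · rintro rfl
      exact ⟨⟨⟨isIrreducible_zeroLocus _, hV⟩, fun W hW hZW => hle W hW.1 hW.2 (hZW hyp)⟩, hyp⟩
  rw [affDimAt]
  simp only [hcomp, Set.ofPred_eq_eq_singleton, Set.mem_singleton_iff, iSup_iSup_eq_left]
  rw [affDim_zeroLocus, ringKrullDim_quotient_span_prime hp, hfin]

end AffineGeometry

/-! ### Homogenization -/

section Homogenization

theorem pderiv_aeval {R σ τ : Type*} [CommRing R] [Fintype σ] (g : σ → MvPolynomial τ R)
    (p : MvPolynomial σ R) (i : τ) :
    pderiv i (aeval g p) = ∑ j, aeval g (pderiv j p) * pderiv i (g j) := by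
  classical
  induction p using MvPolynomial.induction_on with
  | C a => simp [algebraMap_eq]
  | add p q hp hq => simp only [map_add, hp, hq, add_mul, Finset.sum_add_distrib]
  | mul_X p k hp =>
    simp only [map_mul, aeval_X, Derivation.leibniz, hp, smul_eq_mul, pderiv_X, map_add]
    simp only [add_mul, Finset.sum_add_distrib]
    congr 1
    · rw [Finset.sum_eq_single k]
      · simp
      · intro b _ hb
        simp [hb.symm]
      · simp
    · rw [Finset.mul_sum]
      exact Finset.sum_congr rfl fun j _ => by ring

variable {K : Type*} [Field K]

theorem eval_smul_of_isHomogeneous {σ : Type*} {k : ℕ} {p : MvPolynomial σ K}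
    (hp : p.IsHomogeneous k) (t : K) (v : σ → K) : eval (t • v) p = t ^ k * eval v p := by
  rw [eval_eq, eval_eq, Finset.mul_sum]
  refine Finset.sum_congr rfl fun e he => ?_
  rw [hp.degree_eq_sum_deg_support he, ← Finset.prod_pow_eq_pow_sum]
  simp only [Pi.smul_apply, smul_eq_mul, mul_pow, Finset.prod_mul_distrib]
  ring

/-- The homogenization of `R` in degree `D`, with respect to the new variable `X 0`. The
homogeneous components of `R` of degree above `D` are dropped. -/
noncomputable def homogenization {n : ℕ} (D : ℕ) (R : MvPolynomial (Fin n) K) :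
    MvPolynomial (Fin (n + 1)) K :=
  ∑ k ∈ Finset.range (D + 1), X 0 ^ (D - k) * rename Fin.succ (homogeneousComponent k R)

theorem homogenization_isHomogeneous {n : ℕ} (D : ℕ) (R : MvPolynomial (Fin n) K) :
    (homogenization D R).IsHomogeneous D := by
  refine IsHomogeneous.sum _ _ _ fun k hk => ?_
  have hk' : k ≤ D := by simpa [Nat.lt_succ_iff] using hk
  have := (isHomogeneous_X_pow (R := K) (0 : Fin (n + 1)) (D - k)).mul
    ((homogeneousComponent_isHomogeneous k R).rename_isHomogeneous (f := Fin.succ))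
  rwa [Nat.sub_add_cancel hk'] at this

theorem eval_cons_one_homogenization {n : ℕ} {D : ℕ} {R : MvPolynomial (Fin n) K}
    (hR : R.totalDegree ≤ D) (y : Fin n → K) :
    eval (Fin.cons 1 y : Fin (n + 1) → K) (homogenization D R) = eval y R := by
  have h1 : ∑ k ∈ Finset.range (D + 1), homogeneousComponent k R = R := by
    conv_rhs => rw [← sum_homogeneousComponent R]
    refine (Finset.sum_subset (Finset.range_mono (by omega)) fun k _ hk => ?_).symm
    exact homogeneousComponent_eq_zero _ _ (by simpa using hk)
  conv_rhs => rw [← h1]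
  simp only [homogenization, map_sum, map_mul, map_pow, eval_X, eval_rename, Fin.cons_zero, one_pow,
    one_mul]
  rfl

theorem exists_homogenization_eq {n : ℕ} (D : ℕ) (R : MvPolynomial (Fin n) K) :
    ∃ S, homogenization D R = rename Fin.succ (homogeneousComponent D R) + X 0 * S := by
  rw [homogenization, Finset.sum_range_succ, Nat.sub_self, pow_zero, one_mul]
  have : (X 0 : MvPolynomial (Fin (n + 1)) K) ∣
      ∑ k ∈ Finset.range D, X 0 ^ (D - k) * rename Fin.succ (homogeneousComponent k R) := by
    refine Finset.dvd_sum fun k hk => Dvd.dvd.mul_right (dvd_pow_self _ ?_) _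
    have := Finset.mem_range.1 hk
    omega
  obtain ⟨S, hS⟩ := this
  exact ⟨S, by rw [hS]; exact add_comm _ _⟩

theorem not_X_dvd_homogenization {n : ℕ} {D : ℕ} {R : MvPolynomial (Fin n) K}
    (hR : homogeneousComponent D R ≠ 0) : ¬ X 0 ∣ homogenization D R := by
  obtain ⟨S, hS⟩ := exists_homogenization_eq D R
  rintro ⟨U, hU⟩
  apply hR
  have h1 := congrArg
    (aeval (Fin.cons 0 X : Fin (n + 1) → MvPolynomial (Fin n) K)) (hS.symm.trans hU)
  simp only [map_add, map_mul, aeval_rename, aeval_X, Fin.cons_zero, zero_mul, add_zero,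
    Function.comp_def, Fin.cons_succ] at h1
  rwa [aeval_X_left_apply] at h1

/-- A homogeneous polynomial is determined by its dehomogenization. -/
theorem eq_of_eval_cons_one_eq [Infinite K] {n N : ℕ} {G H : MvPolynomial (Fin (n + 1)) K}
    (hG : G.IsHomogeneous N) (hH : H.IsHomogeneous N)
    (h : ∀ y : Fin n → K, eval (Fin.cons 1 y : Fin (n + 1) → K) G =
      eval (Fin.cons 1 y : Fin (n + 1) → K) H) : G = H := by
  have hX : (X 0 : MvPolynomial (Fin (n + 1)) K) ≠ 0 := X_ne_zero 0
  apply mul_left_cancel₀ hX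
  apply MvPolynomial.funext
  intro v
  rw [map_mul, map_mul, eval_X]
  by_cases hv : v 0 = 0
  · rw [hv, zero_mul, zero_mul]
  · have hv' : v = v 0 • (Fin.cons 1 fun i => (v 0)⁻¹ * v i.succ : Fin (n + 1) → K) := by
      ext i
      refine Fin.cases ?_ (fun i => ?_) i
      · simp
      · simp [hv]
    rw [hv', eval_smul_of_isHomogeneous hG, eval_smul_of_isHomogeneous hH, h]

end Homogenization

/-! ### The projective closure of an affine hypersurface -/

section ProjectiveClosure

open scoped Topology

variable {K : Type*} [Field K]

theorem eval_rep_mk_eq_zero_iff {n k : ℕ} {p : MvPolynomial (Fin (n + 1)) K}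
    (hp : p.IsHomogeneous k) (v : Fin (n + 1) → K) (hv : v ≠ 0) :
    eval (Projectivization.mk K v hv).rep p = 0 ↔ eval v p = 0 := by
  obtain ⟨a, ha⟩ := Projectivization.exists_smul_eq_mk_rep K v hv
  rw [← ha, Units.smul_def, eval_smul_of_isHomogeneous hp, mul_eq_zero]
  exact or_iff_right (pow_ne_zero _ a.ne_zero)

theorem isClosed_projZariski_iff {n : ℕ} (C : Set (Proj K n)) :
    IsClosed[projZariski K n] C ↔ ∃ S : Set (MvPolynomial (Fin (n + 1)) K),
      (∀ p ∈ S, ∃ k : ℕ, p.IsHomogeneous k) ∧ C = projZeros S := by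
  rw [← @isOpen_compl_iff _ _ (projZariski K n)]
  change Cᶜᶜ ∈ {C | ∃ S : Set (MvPolynomial (Fin (n + 1)) K),
      (∀ p ∈ S, ∃ k : ℕ, p.IsHomogeneous k) ∧ C = projZeros S} ↔ _
  rw [compl_compl]
  rfl

variable [IsAlgClosed K]

/-- The projective closure of the affine hypersurface `R = 0` is the zero set of the homogenization
of `R`. If a form `G` vanishes on the affine part, the Nullstellensatz gives `G ^ k = R * T` after
dehomogenization, and the homogenization of `R`, which is prime to `X 0`, divides `G ^ k`. -/
theorem mk_mem_pcl_iff {n D : ℕ} {R : MvPolynomial (Fin n) K} (hR : R.totalDegree ≤ D)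
    (hD : homogeneousComponent D R ≠ 0) (v : Fin (n + 1) → K) (hv : v ≠ 0) :
    Projectivization.mk K v hv ∈ pcl {x | eval x R = 0} ↔ eval v (homogenization D R) = 0 := by
  have hhom := homogenization_isHomogeneous D R
  let := projZariski K n
  change _ ∈ closure _ ↔ _
  constructor
  · intro h
    have hcl : IsClosed (projZeros {homogenization D R}) :=
      (isClosed_projZariski_iff _).2 ⟨_, by rintro p rfl; exact ⟨D, hhom⟩, rfl⟩
    have hsub : chart 0 '' {x | eval x R = 0} ⊆ projZeros {homogenization D R} := by
      rintro _ ⟨y, hy, rfl⟩ p rfl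
      rw [chart, eval_rep_mk_eq_zero_iff hhom, Fin.insertNth_zero]
      rw [eval_cons_one_homogenization hR]
      exact hy
    exact (eval_rep_mk_eq_zero_iff hhom v hv).1 (closure_minimal hsub hcl h _ rfl)
  · intro h
    rintro C ⟨hC, hsub⟩
    obtain ⟨S, hS, rfl⟩ := (isClosed_projZariski_iff C).1 hC
    intro G hGS
    obtain ⟨N, hG⟩ := hS G hGS
    rw [eval_rep_mk_eq_zero_iff hG]
    let G₁ : MvPolynomial (Fin n) K := aeval (Fin.cons 1 X : Fin (n + 1) → MvPolynomial (Fin n) K) G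
    have hG₁ : ∀ y, eval y G₁ = eval (Fin.cons 1 y : Fin (n + 1) → K) G := by
      intro y
      have : (aeval y : MvPolynomial (Fin n) K →ₐ[K] K).comp
          (aeval (Fin.cons 1 X : Fin (n + 1) → MvPolynomial (Fin n) K)) =
          aeval (Fin.cons 1 y : Fin (n + 1) → K) := by
        ext i
        refine Fin.cases ?_ (fun i => ?_) i <;> simp
      exact AlgHom.congr_fun this G
    have hrad : G₁ ∈ (Ideal.span {R}).radical := by
      rw [← vanishingIdeal_zeroLocus_eq_radical (K := K)]
      intro y hy
      have hy' : eval y R = 0 := by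
        simpa [aeval_eq_eval] using hy R (Ideal.mem_span_singleton_self R)
      rw [aeval_eq_eval, hG₁]
      have h1 := hsub ⟨y, hy', rfl⟩ G hGS
      rwa [chart, eval_rep_mk_eq_zero_iff hG, Fin.insertNth_zero] at h1
    obtain ⟨k, hk⟩ := hrad
    obtain ⟨T, hT⟩ := Ideal.mem_span_singleton.1 hk
    -- Both sides are homogeneous of the same degree, with dehomogenization `G₁ ^ k = R * T`.
    have heq : (X 0 : MvPolynomial (Fin (n + 1)) K) ^ (D + T.totalDegree) * G ^ k =
        homogenization D R * (X 0 ^ (N * k) * homogenization T.totalDegree T) := by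
      refine eq_of_eval_cons_one_eq (N := D + T.totalDegree + N * k)
        ((isHomogeneous_X_pow _ _).mul (hG.pow k)) ?_ fun y => ?_
      · have := hhom.mul ((isHomogeneous_X_pow (R := K) (0 : Fin (n + 1)) (N * k)).mul
          (homogenization_isHomogeneous T.totalDegree T))
        convert! this using 1
        ring
      · have := congrArg (eval y) hT
        simp only [map_pow, map_mul, hG₁] at this
        simp only [map_mul, map_pow, eval_X, Fin.cons_zero, one_pow, one_mul, this,
          eval_cons_one_homogenization hR, eval_cons_one_homogenization le_rfl]
    obtain ⟨U, hU⟩ := X_prime.pow_dvd_of_dvd_mul_left _ (not_X_dvd_homogenization hD)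
      (Dvd.intro _ heq)
    rw [hU, mul_left_comm] at heq
    have hGk := mul_left_cancel₀ (pow_ne_zero _ (X_ne_zero (R := K) (0 : Fin (n + 1)))) heq
    have := congrArg (eval v) hGk
    rw [map_mul, h, zero_mul, map_pow] at this
    exact eq_zero_of_pow_eq_zero this

/-- The singular points of the projective closure of `R = 0` are common zeros of all partial
derivatives of the homogenization of `R`. In the `i`-th chart the `i`-th partial derivative is
recovered from the others by Euler's identity. -/
theorem projSingularLocus_pcl_subset {n D : ℕ} {R : MvPolynomial (Fin n) K}
    (hR : R.totalDegree ≤ D) (hD : homogeneousComponent D R ≠ 0) :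
    projSingularLocus (pcl {x | eval x R = 0}) ⊆
      projZeros (Set.range fun l => pderiv l (homogenization D R)) := by
  rintro _ ⟨i, y, rfl, hy⟩
  have hhom := homogenization_isHomogeneous D R
  let ins : Fin (n + 1) → MvPolynomial (Fin n) K :=
    i.insertNth (α := fun _ => MvPolynomial (Fin n) K) 1 X
  have hins : ∀ (G : MvPolynomial (Fin (n + 1)) K) (x : Fin n → K),
      eval x (aeval ins G) = eval (i.insertNth (α := fun _ => K) 1 x) G := by
    intro G x
    have : (aeval x : MvPolynomial (Fin n) K →ₐ[K] K).comp (aeval ins) =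
        aeval (i.insertNth (α := fun _ => K) 1 x) := by
      ext l
      refine Fin.succAboveCases i ?_ (fun l => ?_) l <;> simp [ins]
    have := AlgHom.congr_fun this G
    simpa [aeval_eq_eval] using this
  have hV : chart i ⁻¹' pcl {x | eval x R = 0} =
      {x | eval x (aeval ins (homogenization D R)) = 0} := by
    ext x
    rw [Set.mem_preimage, chart, mk_mem_pcl_iff hR hD, Set.mem_ofPred_eq, hins]
  rw [hV] at hy
  have hval : eval (i.insertNth (α := fun _ => K) 1 y) (homogenization D R) = 0 := by
    rw [← hins]; exact hy.1
  have hsucc : ∀ j, eval (i.insertNth (α := fun _ => K) 1 y)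
      (pderiv (i.succAbove j) (homogenization D R)) = 0 := by
    intro j
    by_contra hne
    refine not_isAffSingularPoint_of_pderiv_ne_zero (j := j) ?_ hy
    rw [pderiv_aeval, Fin.sum_univ_succAbove _ i]
    simp only [ins, Fin.insertNth_apply_same, Fin.insertNth_apply_succAbove, pderiv_one, mul_zero,
      zero_add, pderiv_X]
    rw [Finset.sum_eq_single j]
    · rw [Pi.single_eq_same, mul_one, hins]
      exact hne
    · intro l _ hl
      simp [hl.symm]
    · simp
  have hi : eval (i.insertNth (α := fun _ => K) 1 y) (pderiv i (homogenization D R)) = 0 := by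
    have := congrArg (eval (i.insertNth (α := fun _ => K) 1 y)) hhom.sum_X_mul_pderiv
    rw [Fin.sum_univ_succAbove _ i] at this
    simpa [hsucc, hval] using this
  rintro _ ⟨l, rfl⟩
  rw [chart, eval_rep_mk_eq_zero_iff hhom.pderiv]
  exact Fin.succAboveCases i hi hsucc l

end ProjectiveClosure

/-! ### Dimension of projective varieties and hyperplane sections -/

section ProjectiveDimension

open scoped Topology

variable {K : Type*} [Field K]

theorem projDim_mono {n : ℕ} {V W : Set (Proj K n)} (h : V ⊆ W) : projDim V ≤ projDim W :=
  let := projZariski K n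
  (Topology.IsEmbedding.inclusion h).isInducing.topologicalKrullDim_le

/-- The punctured affine cone over a subset of projective space. -/
def puncturedCone {n : ℕ} (W : Set (Proj K n)) : Set (Fin (n + 1) → K) :=
  {v | ∃ hv : v ≠ 0, Projectivization.mk K v hv ∈ W}

theorem smul_mem_puncturedCone {n : ℕ} {W : Set (Proj K n)} {v : Fin (n + 1) → K}
    (hv : v ∈ puncturedCone W) {t : K} (ht : t ≠ 0) : t • v ∈ puncturedCone W := by
  obtain ⟨h0, hW⟩ := hv
  refine ⟨smul_ne_zero ht h0, ?_⟩
  convert hW using 1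
  rw [Projectivization.mk_eq_mk_iff']
  exact ⟨t, rfl⟩

theorem mem_vanishingIdeal_puncturedCone_iff {n k : ℕ} {W : Set (Proj K n)}
    {p : MvPolynomial (Fin (n + 1)) K} (hp : p.IsHomogeneous k) :
    p ∈ vanishingIdeal K (puncturedCone W) ↔ W ⊆ projZeros {p} := by
  constructor
  · rintro h x hx _ rfl
    have := h x.rep ⟨x.rep_nonzero, by rwa [x.mk_rep]⟩
    simpa [aeval_eq_eval] using this
  · rintro h v ⟨hv, hW⟩
    rw [aeval_eq_eval]
    exact (eval_rep_mk_eq_zero_iff hp v hv).1 (h hW p rfl)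

theorem homogeneousComponent_mem_vanishingIdeal_puncturedCone [Infinite K] {n : ℕ}
    {W : Set (Proj K n)} {p : MvPolynomial (Fin (n + 1)) K}
    (hp : p ∈ vanishingIdeal K (puncturedCone W)) (k : ℕ) :
    homogeneousComponent k p ∈ vanishingIdeal K (puncturedCone W) := by
  intro v hv
  rw [aeval_eq_eval]
  -- `P(t)` is the value of `p` at `t • v`, as a polynomial in `t`.
  let P : Polynomial K := ∑ k ∈ Finset.range (p.totalDegree + 1),
    Polynomial.monomial k (eval v (homogeneousComponent k p))
  have hP : ∀ t, P.eval t = eval (t • v) p := by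
    intro t
    conv_rhs => rw [← sum_homogeneousComponent p]
    simp only [P, Polynomial.eval_finsetSum, Polynomial.eval_monomial, map_sum]
    refine Finset.sum_congr rfl fun k _ => ?_
    rw [eval_smul_of_isHomogeneous (homogeneousComponent_isHomogeneous k p), mul_comm]
  have hP0 : P = 0 := by
    have : Polynomial.X * P = 0 := by
      apply Polynomial.funext
      intro t
      rw [Polynomial.eval_mul, Polynomial.eval_X, hP, Polynomial.eval_zero]
      by_cases ht : t = 0
      · rw [ht, zero_mul]
      · have := hp _ (smul_mem_puncturedCone hv ht)
        rw [aeval_eq_eval] at this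
        rw [this, mul_zero]
    exact (mul_eq_zero.1 this).resolve_left Polynomial.X_ne_zero
  by_cases hk : p.totalDegree < k
  · rw [homogeneousComponent_eq_zero _ _ hk, map_zero]
  · have := congrArg (Polynomial.coeff · k) hP0
    simpa [P, Polynomial.finsetSum_coeff, Polynomial.coeff_monomial, Nat.lt_succ_iff,
      not_lt.1 hk] using this

attribute [local instance] MvPolynomial.gradedAlgebra in
theorem isPrime_vanishingIdeal_puncturedCone [Infinite K] {n : ℕ} {W : Set (Proj K n)}
    (hW : @IsIrreducible _ (projZariski K n) W) :
    (vanishingIdeal K (puncturedCone W)).IsPrime := by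
  refine Ideal.IsHomogeneous.isPrime_of_homogeneous_mem_or_mem
    (𝒜 := homogeneousSubmodule (Fin (n + 1)) K) ?_ ?_ ?_
  · intro k p hp
    have : ((DirectSum.decompose (homogeneousSubmodule (Fin (n + 1)) K) p k :
        homogeneousSubmodule (Fin (n + 1)) K k) : MvPolynomial (Fin (n + 1)) K) =
        homogeneousComponent k p := decomposition.decompose'_apply p k
    rw [this]
    exact homogeneousComponent_mem_vanishingIdeal_puncturedCone hp k
  · obtain ⟨x, hx⟩ := hW.1
    rw [Ideal.ne_top_iff_one]
    intro h1
    simpa using h1 x.rep ⟨x.rep_nonzero, by rwa [x.mk_rep]⟩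
  · rintro p q ⟨k, hp⟩ ⟨l, hq⟩ hpq
    rw [mem_homogeneousSubmodule] at hp hq
    rw [mem_vanishingIdeal_puncturedCone_iff (hp.mul hq)] at hpq
    rw [mem_vanishingIdeal_puncturedCone_iff hp, mem_vanishingIdeal_puncturedCone_iff hq]
    refine (@isPreirreducible_iff_isClosed_union_isClosed _ (projZariski K n) W).1 hW.2 _ _
      ((isClosed_projZariski_iff _).2 ⟨_, ?_, rfl⟩) ((isClosed_projZariski_iff _).2 ⟨_, ?_, rfl⟩) ?_
    · rintro _ rfl; exact ⟨k, hp⟩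
    · rintro _ rfl; exact ⟨l, hq⟩
    · intro x hx
      have := hpq hx _ rfl
      rw [map_mul, mul_eq_zero] at this
      simpa [projZeros] using this

theorem subset_of_vanishingIdeal_puncturedCone_le {n : ℕ} {C D : Set (Proj K n)}
    (hC : IsClosed[projZariski K n] C)
    (h : vanishingIdeal K (puncturedCone C) ≤ vanishingIdeal K (puncturedCone D)) : D ⊆ C := by
  obtain ⟨S, hS, rfl⟩ := (isClosed_projZariski_iff _).1 hC
  intro x hx p hp
  obtain ⟨k, hk⟩ := hS p hp
  have h1 : p ∈ vanishingIdeal K (puncturedCone (projZeros S)) :=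
    (mem_vanishingIdeal_puncturedCone_iff hk).2 fun y hy q hq => hq ▸ hy p hp
  exact (mem_vanishingIdeal_puncturedCone_iff hk).1 (h h1) hx p rfl

/-- The ideal of a nonempty projective set lies strictly below the irrelevant ideal. -/
theorem vanishingIdeal_puncturedCone_lt [Infinite K] {n : ℕ} {W : Set (Proj K n)}
    (hW : W.Nonempty) : vanishingIdeal K (puncturedCone W) <
    vanishingIdeal K {(0 : Fin (n + 1) → K)} := by
  obtain ⟨x, hx⟩ := hW
  have hxW : x.rep ∈ puncturedCone W := ⟨x.rep_nonzero, by rwa [x.mk_rep]⟩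
  refine lt_of_le_of_ne (fun p hp => ?_) fun h => ?_
  · rw [mem_vanishingIdeal_singleton_iff]
    have := homogeneousComponent_mem_vanishingIdeal_puncturedCone hp 0 _ hxW
    rw [homogeneousComponent_zero] at this
    rw [aeval_eq_eval, ← constantCoeff_eq, ← eval_zero'] at *
    simpa using this
  · apply x.rep_nonzero
    ext i
    have : (X i : MvPolynomial (Fin (n + 1)) K) ∈ vanishingIdeal K (puncturedCone W) := by
      rw [h, mem_vanishingIdeal_singleton_iff]; simp
    simpa using this _ hxW

/-- A hyperplane section lowers the dimension of a projective variety by at most one: the variety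
`S = 0` has dimension at most that of the affine cone over its section with `X 0 = 0`. A chain of
irreducible closed subsets gives a chain of homogeneous primes which can be extended by the
irrelevant ideal, and the latter contains `X 0`. -/
theorem projDim_projZeros_le [Infinite K] {n : ℕ} (S : Set (MvPolynomial (Fin (n + 1)) K))
    (hS : ∀ p ∈ S, ∃ k : ℕ, p.IsHomogeneous k) (N : ℕ)
    (h : ringKrullDim (MvPolynomial (Fin (n + 1)) K ⧸ (Ideal.span S ⊔ Ideal.span {X 0})) ≤
      (N : WithBot ℕ∞)) :
    projDim (projZeros S) ≤ (N : WithBot ℕ∞) := by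
  let := projZariski K n
  have hcl : IsClosed (projZeros S) := (isClosed_projZariski_iff _).2 ⟨S, hS, rfl⟩
  let I := Ideal.span S
  have h' : ringKrullDim ((MvPolynomial (Fin (n + 1)) K ⧸ I) ⧸
      Ideal.span {Ideal.Quotient.mk I (X 0)}) ≤ (N : WithBot ℕ∞) := by
    rw [← Set.image_singleton, ← Ideal.map_span]
    exact (ringKrullDim_eq_of_ringEquiv
      (DoubleQuot.quotQuotEquivQuotSup I (Ideal.span {X 0}))).trans_le h
  let e := I.primeSpectrumQuotientOrderIsoZeroLocus
  have hemem : ∀ (P : PrimeSpectrum.zeroLocus (I : Set (MvPolynomial (Fin (n + 1)) K))) p,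
      Ideal.Quotient.mk I p ∈ (e.symm P).asIdeal ↔ p ∈ P.1.asIdeal := by
    intro P p
    conv_rhs => rw [← e.apply_symm_apply P]
    rfl
  let cone : (TopologicalSpace.IrreducibleCloseds (projZeros S))ᵒᵈ → Set (Fin (n + 1) → K) :=
    fun W => puncturedCone
      (Subtype.val '' ((OrderDual.ofDual W : TopologicalSpace.IrreducibleCloseds (projZeros S)) :
        Set (projZeros S)))
  let Φ : (TopologicalSpace.IrreducibleCloseds (projZeros S))ᵒᵈ →
      PrimeSpectrum.zeroLocus (I : Set (MvPolynomial (Fin (n + 1)) K)) := fun W =>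
    ⟨⟨vanishingIdeal K (cone W),
      isPrime_vanishingIdeal_puncturedCone
        ((OrderDual.ofDual W).isIrreducible.image _ continuous_subtype_val.continuousOn)⟩, by
      change I ≤ _
      refine Ideal.span_le.2 fun p hp => ?_
      obtain ⟨k, hk⟩ := hS p hp
      refine (mem_vanishingIdeal_puncturedCone_iff hk).2 ?_
      rintro _ ⟨x, _, rfl⟩ _ rfl
      exact x.2 _ hp⟩
  have hΦ : StrictMono Φ := by
    refine Monotone.strictMono_of_injective (fun W W' hW => ?_) fun W W' hW => ?_
    · refine vanishingIdeal_anti_mono ?_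
      rintro v ⟨hv, hvW⟩
      exact ⟨hv, Set.image_mono hW hvW⟩
    · have h1 : vanishingIdeal K (cone W) =
          vanishingIdeal K (cone W') :=
        congrArg (fun P => P.1.asIdeal) hW
      have h2 := subset_of_vanishingIdeal_puncturedCone_le
        (hcl.isClosedMap_subtype_val _ (OrderDual.ofDual W).isClosed) h1.le
      have h3 := subset_of_vanishingIdeal_puncturedCone_le
        (hcl.isClosedMap_subtype_val _ (OrderDual.ofDual W').isClosed) h1.ge
      have h4 := Subtype.val_injective.image_injective (h3.antisymm h2)
      exact congrArg OrderDual.toDual (TopologicalSpace.IrreducibleCloseds.ext h4)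
  change Order.krullDim (TopologicalSpace.IrreducibleCloseds (projZeros S)) ≤ _
  rw [← Order.krullDim_orderDual, Order.krullDim_eq_iSup_height, iSup_le_iff]
  intro W
  have hlt : (Φ W).1.asIdeal < vanishingIdeal K {0} :=
    vanishingIdeal_puncturedCone_lt ((OrderDual.ofDual W).isIrreducible.1.image _)
  -- The irrelevant ideal, which lies strictly above all primes in the image of `Φ`.
  let m : PrimeSpectrum.zeroLocus (I : Set (MvPolynomial (Fin (n + 1)) K)) :=
    ⟨⟨vanishingIdeal K {0}, inferInstance⟩, (Φ W).2.trans hlt.le⟩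
  have hm : Φ W < m := hlt
  have hX : Ideal.Quotient.mk I (X 0) ∈ (e.symm m).asIdeal := by
    rw [hemem]
    change X 0 ∈ vanishingIdeal K {0}
    rw [mem_vanishingIdeal_singleton_iff]
    simp
  have h1 := Ideal.height_le_ringKrullDim_quotient_add_one hX
  have h2 : Order.height W + 1 ≤ (e.symm m).asIdeal.height := by
    rw [PrimeSpectrum.height_eq_orderHeight, Order.height_orderIso]
    exact (add_le_add_left (Order.height_le_height_apply_of_strictMono Φ hΦ W) 1).trans
      (Order.height_add_one_le hm)
  have h3 : ((Order.height W + 1 : ℕ∞) : WithBot ℕ∞) ≤ ((N + 1 : ℕ∞) : WithBot ℕ∞) := by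
    refine (WithBot.coe_le_coe.2 h2).trans (h1.trans ?_)
    push_cast
    gcongr
  have h4 : Order.height W + 1 ≤ (N : ℕ∞) + 1 := WithBot.coe_le_coe.1 h3
  have h5 : Order.height W ≤ N := (ENat.add_le_add_iff_right (by simp)).1 h4
  exact WithBot.coe_le_coe.2 h5

end ProjectiveDimension

/-! ### Reduction to the top form -/

section TopForm

/-- A bound for the section with `X 0 = 0` of the scheme cut out by the partial derivatives of the
homogenization of `R`: in its coordinate ring `B` the relations `∂T/∂Xᵢ = 0` hold, where `T` is the
top form of `R`. -/
theorem ringKrullDim_le_of_pderiv_homogenization {K B : Type*} [Field K] [CommRing B] [Algebra K B]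
    {n d D : ℕ} {R : MvPolynomial (Fin n) K} {a : Fin d → ℕ} (ha : Function.Injective a)
    (c : Fin d → MvPolynomial (Fin n) K) {k : Fin d} (hc : IsUnit (c k))
    (h : ∀ i, pderiv i (homogeneousComponent D R) = ∑ j, c j * X i ^ a j)
    (π : MvPolynomial (Fin (n + 1)) K →ₐ[K] B) (hπ : Function.Surjective π) (hπ0 : π (X 0) = 0)
    (hπS : ∀ l, π (pderiv l (homogenization D R)) = 0) :
    ringKrullDim B ≤ ((d - 1 : ℕ) : WithBot ℕ∞) := by
  refine ringKrullDim_le_of_relation (K := K) ha (fun i : Fin n => π (X i.succ)) ?_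
    (fun j => π (rename Fin.succ (c j))) (k := k) ((hc.map _).map π) fun i => ?_
  · rw [eq_top_iff, ← (AlgHom.range_eq_top π).2 hπ, ← Algebra.map_top, ← adjoin_range_X,
      AlgHom.map_adjoin]
    refine Algebra.adjoin_le ?_
    rintro _ ⟨_, ⟨l, rfl⟩, rfl⟩
    refine Fin.cases ?_ (fun l => ?_) l
    · rw [SetLike.mem_coe, hπ0]; exact zero_mem _
    · exact Algebra.subset_adjoin ⟨l, rfl⟩
  · obtain ⟨U, hU⟩ := exists_homogenization_eq D R
    have h1 := hπS i.succ
    rw [hU, map_add, pderiv_rename (Fin.succ_injective n), h, pderiv_mul,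
      pderiv_X_of_ne (Fin.succ_ne_zero i).symm, zero_mul, zero_add] at h1
    simpa [hπ0] using h1

/-- If the top form vanished, the relations would hold in the whole polynomial ring, which
would have dimension less than `d`. -/
theorem homogeneousComponent_ne_zero_of_pderiv {K : Type*} [Field K] {n d D : ℕ}
    {R : MvPolynomial (Fin n) K} {a : Fin d → ℕ}
    (ha : Function.Injective a) (c : Fin d → MvPolynomial (Fin n) K) {k : Fin d}
    (hc : IsUnit (c k))
    (h : ∀ i, pderiv i (homogeneousComponent D R) = ∑ j, c j * X i ^ a j) (hdn : d ≤ n) :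
    homogeneousComponent D R ≠ 0 := by
  have hd : 0 < d := k.pos
  intro h0
  have h1 := ringKrullDim_le_of_relation (K := K) ha (X : Fin n → MvPolynomial (Fin n) K)
    adjoin_range_X c hc fun i => by rw [← h, h0, map_zero]
  rw [MvPolynomial.ringKrullDim_of_isNoetherianRing, ringKrullDim_eq_zero_of_field,
    zero_add, Nat.card_fin] at h1
  have : n ≤ d - 1 := by exact_mod_cast h1
  omega

/-- The dimension bound, in terms of the top form `T` of `R`: it suffices that the gradient of `T`
has the shape `∂T/∂Xᵢ = ∑ⱼ cⱼ Xᵢ ^ aⱼ` with `d` distinct exponents and one invertible coefficient.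
That `T ≠ 0` follows from this. -/
theorem projDim_projSingularLocus_pcl_le {K : Type*} [Field K] [IsAlgClosed K] {n d D : ℕ}
    {R : MvPolynomial (Fin n) K} (hR : R.totalDegree ≤ D) {a : Fin d → ℕ}
    (ha : Function.Injective a) (c : Fin d → MvPolynomial (Fin n) K) {k : Fin d}
    (hc : IsUnit (c k))
    (h : ∀ i, pderiv i (homogeneousComponent D R) = ∑ j, c j * X i ^ a j) (hdn : d ≤ n) :
    projDim (projSingularLocus (pcl {x | eval x R = 0})) ≤ ((d - 1 : ℕ) : WithBot ℕ∞) := by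
  have hD := homogeneousComponent_ne_zero_of_pderiv ha c hc h hdn
  have hhom := homogenization_isHomogeneous D R
  refine (projDim_mono (projSingularLocus_pcl_subset hR hD)).trans ?_
  refine projDim_projZeros_le _ (by rintro _ ⟨l, rfl⟩; exact ⟨_, hhom.pderiv⟩) _ ?_
  refine ringKrullDim_le_of_pderiv_homogenization ha c hc h
    (Ideal.Quotient.mkₐ K _) (Ideal.Quotient.mkₐ_surjective K _)
    (Ideal.Quotient.eq_zero_iff_mem.2 (Ideal.mem_sup_right (Ideal.mem_span_singleton_self _)))
    fun l => Ideal.Quotient.eq_zero_iff_mem.2 (Ideal.mem_sup_left (Ideal.subset_span ⟨l, rfl⟩))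

end TopForm

/-! ### Polynomials in power sums -/

section PowerSumForms

variable {F : Type*} [Field F]

theorem pderiv_psum (n k : ℕ) (i : Fin n) :
    pderiv i (psum (Fin n) F k) = C (k : F) * X i ^ (k - 1) := by
  rw [psum, map_sum, Finset.sum_eq_single i]
  · rw [pderiv_pow, pderiv_X_self, mul_one]; simp
  · intro j _ hj
    rw [pderiv_pow, pderiv_X_of_ne hj, mul_zero]
  · simp

theorem psum_isHomogeneous (n k : ℕ) : (psum (Fin n) F k).IsHomogeneous k :=
  IsHomogeneous.sum _ _ _ fun i _ => isHomogeneous_X_pow i k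

variable {d n : ℕ} (m : Fin d → ℕ)

theorem isHomogeneous_aeval_psum_monomial (s : Fin d →₀ ℕ) (r : F) :
    (aeval (fun j => psum (Fin n) F (m j)) (monomial s r)).IsHomogeneous
      (Finsupp.weight m s) := by
  rw [aeval_monomial, Finsupp.weight_apply, Finsupp.prod, Finsupp.sum]
  refine IsHomogeneous.C_mul (IsHomogeneous.prod _ _ _ fun j _ => ?_) r
  rw [smul_eq_mul, mul_comm]
  exact (psum_isHomogeneous n (m j)).pow (s j)

theorem homogeneousComponent_aeval_psum (D : ℕ) (f : MvPolynomial (Fin d) F) :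
    homogeneousComponent D (aeval (fun j => psum (Fin n) F (m j)) f) =
      aeval (fun j => psum (Fin n) F (m j)) (weightedHomogeneousComponent m D f) := by
  induction f using MvPolynomial.induction_on' with
  | monomial s r =>
    rw [homogeneousComponent_of_mem (isHomogeneous_aeval_psum_monomial m s r),
      weightedHomogeneousComponent_of_mem
        (isWeightedHomogeneous_monomial m s r rfl)]
    split_ifs <;> simp
  | add p q hp hq => simp only [map_add, hp, hq]

theorem totalDegree_aeval_psum_le (f : MvPolynomial (Fin d) F) :
    (aeval (fun j => psum (Fin n) F (m j)) f).totalDegree ≤ weightedTotalDegree m f := by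
  conv_lhs => rw [f.as_sum, map_sum]
  refine totalDegree_finsetSum_le fun s hs => ?_
  exact (isHomogeneous_aeval_psum_monomial m s _).totalDegree_le.trans
    (le_weightedTotalDegree m hs)

/-- A nonvanishing gradient of `f^wt` at the origin forces `f^wt` to contain a linear term in some
`Y_k`. By weights `f^wt` has then degree one in `Y_k`, with constant coefficient. -/
theorem exists_pderiv_topWeightComponent (hm : ∀ j, 0 < m j) (f : MvPolynomial (Fin d) F)
    (H : GradientNowhereZero (topWeightComponent m f)) :
    ∃ k, weightedTotalDegree m f = m k ∧ coeff (Finsupp.single k 1) f ≠ 0 ∧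
      pderiv k (topWeightComponent m f) = C (coeff (Finsupp.single k 1) f) := by
  obtain ⟨k, hk⟩ := H 0
  have h1 : coeff 0 (pderiv k (topWeightComponent m f)) ≠ 0 := by
    intro h0
    apply hk
    rw [aeval_zero, constantCoeff_eq, h0, map_zero]
  rw [coeff_pderiv, topWeightComponent, coeff_weightedHomogeneousComponent] at h1
  simp only [zero_add, Finsupp.weight_single, one_smul, Finsupp.coe_zero, Pi.zero_apply,
    Nat.cast_zero, mul_one, ne_eq, ite_eq_right_iff, Classical.not_imp] at h1
  refine ⟨k, h1.1.symm, h1.2, ?_⟩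
  ext s
  rw [coeff_pderiv, topWeightComponent, coeff_weightedHomogeneousComponent, coeff_C]
  by_cases hs : 0 = s
  · subst hs
    simp [h1.1, Finsupp.weight_single]
  · have hs' : Finsupp.weight m s ≠ 0 := by
      obtain ⟨j, hj⟩ := Finsupp.ne_iff.1 (Ne.symm hs)
      have := Finsupp.le_weight_of_ne_zero' m hj
      have := hm j
      omega
    rw [if_neg, zero_mul, if_neg hs]
    rw [map_add, Finsupp.weight_single, one_smul]
    omega

/-- The bound for a polynomial over `F` whose top form is `h(P_{m_1}, …, P_{m_d})`, where some
partial derivative of `h` is a nonzero constant. The chain rule gives the gradient of the top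
form. -/
theorem projDim_projSingularLocus_le_of_top_eq (hm : Function.Injective m) (hm2 : ∀ j, 0 < m j)
    (hmF : ∀ j, (m j : F) ≠ 0) {D : ℕ} {R : MvPolynomial (Fin n) F} (hR : R.totalDegree ≤ D)
    (h : MvPolynomial (Fin d) F)
    (hT : homogeneousComponent D R = aeval (fun j => psum (Fin n) F (m j)) h) {k : Fin d} {r : F}
    (hr : r ≠ 0) (hk : pderiv k h = C r) (hdn : d ≤ n) :
    projDim (projSingularLocus (pcl {x : Fin n → AlgebraicClosure F | aeval x R = 0})) ≤
      ((d - 1 : ℕ) : WithBot ℕ∞) := by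
  let φ : MvPolynomial (Fin n) F →+* MvPolynomial (Fin n) (AlgebraicClosure F) :=
    map (algebraMap F (AlgebraicClosure F))
  have hset : {x : Fin n → AlgebraicClosure F | aeval x R = 0} = {x | eval x (φ R) = 0} := by
    ext x
    simp only [Set.mem_ofPred_eq, φ, eval_map, aeval_def]
  have hcomp : homogeneousComponent D (φ R) = φ (homogeneousComponent D R) := by
    ext s
    simp only [φ, coeff_homogeneousComponent, coeff_map]
    split_ifs <;> simp
  rw [hset]
  refine projDim_projSingularLocus_pcl_le (D := D) (a := fun j => m j - 1) (k := k)
    ((Finset.sup_mono (support_map_subset _ _)).trans hR) ?_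
    (fun j => φ (aeval (fun j => psum (Fin n) F (m j)) (pderiv j h) * C (m j : F))) ?_ ?_ hdn
  · intro i j hij
    have h1 := hm2 i
    have h2 := hm2 j
    exact hm (by simp only at hij; omega)
  · refine IsUnit.map φ ?_
    rw [hk, aeval_C, algebraMap_eq, ← C_mul]
    exact (mul_ne_zero hr (hmF k)).isUnit.map C
  · intro i
    rw [hcomp, hT]
    simp only [φ, pderiv_map]
    rw [pderiv_aeval, map_sum]
    refine Finset.sum_congr rfl fun j _ => ?_
    rw [pderiv_psum, map_mul, map_mul, map_mul, map_pow, map_X, mul_assoc]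

end PowerSumForms

end DeformedHypersurface

theorem mainTheorem11 {F : Type*} [Field F] [Finite F] (d n : ℕ) (hd : 1 ≤ d) (hdn : d + 3 ≤ n)
    (m : Fin d → ℕ) (hm : StrictMono m) (hm2 : ∀ j, 2 ≤ m j) (hmchar : ∀ j, ¬ ringChar F ∣ m j)
    (f : MvPolynomial (Fin d) F)
    (H1 : DeformedHypersurface.GradientNowhereZero f)
    (H2 : DeformedHypersurface.GradientNowhereZero
      (DeformedHypersurface.topWeightComponent m f)) :
    (∀ (e : ℕ) (g₁ : MvPolynomial (Fin n) F), 0 < e → ¬ ringChar F ∣ e → g₁.totalDegree < e →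
      (∀ j, m j = e → MvPolynomial.weightedTotalDegree m f = e →
        MvPolynomial.coeff (Finsupp.single j 1) f ≠ -1) →
      DeformedHypersurface.projDim (DeformedHypersurface.projSingularLocus
        (DeformedHypersurface.pcl (DeformedHypersurface.Vg m f
          (∑ i, MvPolynomial.X i ^ e + g₁)))) ≤ ((d : ℕ) : WithBot ℕ∞)) ∧
    (∀ c : F,
      DeformedHypersurface.projDim (DeformedHypersurface.projSingularLocus
        (DeformedHypersurface.pcl (DeformedHypersurface.Vg m f
          (MvPolynomial.C c : MvPolynomial (Fin n) F)))) ≤ ((d - 1 : ℕ) : WithBot ℕ∞)) := by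
  have hchar : ∀ {k : ℕ}, ¬ ringChar F ∣ k → (k : F) ≠ 0 := fun hk h0 => hk (ringChar.dvd h0)
  have hmpos : ∀ j, 0 < m j := fun j => by have := hm2 j; omega
  obtain ⟨k, hwt, hcoeff, hk⟩ :=
    DeformedHypersurface.exists_pderiv_topWeightComponent m hmpos f H2
  have hfdeg := DeformedHypersurface.totalDegree_aeval_psum_le (n := n) m f
  have hftop := DeformedHypersurface.homogeneousComponent_aeval_psum (n := n) m
    (weightedTotalDegree m f) f
  -- When `g` has degree below the weight of `f`, the top form is `f^wt(P_{m_1}, …, P_{m_d})`.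
  have hlow : ∀ g : MvPolynomial (Fin n) F, g.totalDegree < weightedTotalDegree m f →
      DeformedHypersurface.projDim (DeformedHypersurface.projSingularLocus
        (DeformedHypersurface.pcl (DeformedHypersurface.Vg m f g))) ≤
          ((d - 1 : ℕ) : WithBot ℕ∞) := by
    intro g hg
    refine DeformedHypersurface.projDim_projSingularLocus_le_of_top_eq m hm.injective hmpos
      (fun j => hchar (hmchar j)) (D := weightedTotalDegree m f)
      ((totalDegree_add _ _).trans (max_le hfdeg hg.le))
      (DeformedHypersurface.topWeightComponent m f) ?_ hcoeff hk (by omega)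
    rw [DeformedHypersurface.Rpoly, map_add, hftop, homogeneousComponent_eq_zero _ _ hg, add_zero]
    rfl
  refine ⟨fun e g₁ he hechar hg₁ hcancel => ?_, fun c => hlow _ ?_⟩
  · have hPe := DeformedHypersurface.psum_isHomogeneous (F := F) n e
    have hgdeg : (psum (Fin n) F e + g₁).totalDegree ≤ e :=
      (totalDegree_add _ _).trans (max_le hPe.totalDegree_le hg₁.le)
    have hgtop : homogeneousComponent e (psum (Fin n) F e + g₁) = psum (Fin n) F e := by
      rw [map_add, homogeneousComponent_eq_zero _ _ hg₁, add_zero,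
        homogeneousComponent_eq_self hPe]
    change DeformedHypersurface.projDim (DeformedHypersurface.projSingularLocus
      (DeformedHypersurface.pcl (DeformedHypersurface.Vg m f (psum (Fin n) F e + g₁)))) ≤ _
    have hle : ((d - 1 : ℕ) : WithBot ℕ∞) ≤ ((d : ℕ) : WithBot ℕ∞) := by
      exact_mod_cast Nat.sub_le d 1
    refine le_trans ?_ hle
    rcases lt_trichotomy e (weightedTotalDegree m f) with hlt | heq | hgt
    · exact hlow _ (hgdeg.trans_lt hlt)
    · -- The top form is `(f^wt + Y_k)(P_{m_1}, …, P_{m_d})`, where `e = m_k`.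
      refine DeformedHypersurface.projDim_projSingularLocus_le_of_top_eq m hm.injective hmpos
        (fun j => hchar (hmchar j)) (D := e) (k := k) (r := coeff (Finsupp.single k 1) f + 1)
        ((totalDegree_add _ _).trans (max_le (hfdeg.trans heq.ge) hgdeg))
        (DeformedHypersurface.topWeightComponent m f + X k) ?_ ?_ ?_ (by omega)
      · rw [DeformedHypersurface.Rpoly, map_add, hgtop, heq, hftop, map_add, aeval_X, ← hwt]
        rfl
      · have := hcancel k (hwt.symm.trans heq.symm) heq.symm
        rwa [Ne, ← eq_neg_iff_add_eq_zero]
      · rw [map_add, hk, pderiv_X_self, C_add, C_1]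
    · -- The top form is the single power sum `P_e`.
      refine (DeformedHypersurface.projDim_projSingularLocus_le_of_top_eq (d := 1) (fun _ => e)
        (Function.injective_of_subsingleton _) (fun _ => he)
        (fun _ => hchar hechar) (D := e) (k := 0) (r := 1)
        ((totalDegree_add _ _).trans (max_le (hfdeg.trans hgt.le) hgdeg))
        (X 0) ?_ one_ne_zero ?_ (by omega)).trans ?_
      · rw [map_add, hgtop, homogeneousComponent_eq_zero _ _ (hfdeg.trans_lt hgt), zero_add,
          aeval_X]
      · rw [pderiv_X_self, C_1]
      · exact_mod_cast Nat.zero_le (d - 1)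
  · rw [totalDegree_C, hwt]
    exact hmpos k
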